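/- Let $N\in\mathbb N$ and let $T:\mathbb R_+^N\to\mathbb R_{++}^N$ be continuous and concave with respect to the entry-wise order. Let $\|\cdot\|_a$ be a monotone norm on $\mathbb R^N$, i.e. a norm such that $\|x\|_a\ge\|y\|_a$ whenever $x\ge y\ge 0$ entry-wise. For $\bar p>0$ consider the problem $$\text{maximize } c\quad\text{subject to}\quad p=cT(p),\quad \|p\|_a\le\bar p,\quad p\in\mathbb R_+^N,\ c>0.$$ Let $M\in\mathbb R_+^{N\times N}$ be the lower bounding matrix of $T=[t_1,\dots,t_N]$, given by $[M]_{i,j}=\lim_{h\to0^+}h\,t_i(h^{-1}e_j)$, where $e_j$ is the $j$th unit vector, and assume that its spectral radius satisfies $\rho(M)>0$. Then, for every $\bar p>0$, the problem has a unique solution $(p_{\bar p},c_{\bar p})$, and the utility function $U:\bar p\mapsto c_{\bar p}$ satisfies $U(\bar p)\in\Theta(1)$ as $\bar p\to\infty$; i.e. there are constants $k_0,k_1,k_2>0$ such that $k_1\le U(\bar p)\le k_2$ for every $\bar p\ge k_0$. -/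

import Mathlib

open Filter Topology

namespace MaxMinUtility

/-- The nonnegative orthant of `ℝ^N`. -/
def orthant (N : ℕ) : Set (Fin N → ℝ) := {x | 0 ≤ x}

/-- `T : ℝ₊^N → ℝ₊₊^N` is a positive, continuous, concave (interference) mapping. The map is given
as a function on all of `ℝ^N`; only its values on the nonnegative orthant matter. Concavity is with
respect to the entry-wise order. -/
structure IsInterferenceMapping {N : ℕ} (T : (Fin N → ℝ) → (Fin N → ℝ)) : Prop where
  pos : ∀ x ∈ orthant N, ∀ i, 0 < T x i
  continuousOn : ContinuousOn T (orthant N)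
  concaveOn : ConcaveOn ℝ (orthant N) T

/-- A seminorm on `ℝ^N` that is a norm and is monotone on the nonnegative orthant. -/
structure IsMonotoneNorm {N : ℕ} (a : Seminorm ℝ (Fin N → ℝ)) : Prop where
  eq_zero : ∀ x, a x = 0 → x = 0
  mono : ∀ x ∈ orthant N, ∀ y ∈ orthant N, y ≤ x → a y ≤ a x

/-- The lower bounding matrix of `T`: its `(i, j)` entry is `lim_{h → 0⁺} h * t_i (h⁻¹ e_j)`. -/
noncomputable def lowerBoundingMatrix {N : ℕ} (T : (Fin N → ℝ) → (Fin N → ℝ)) :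
    Matrix (Fin N) (Fin N) ℝ :=
  Matrix.of fun i j => limUnder (𝓝[>] (0 : ℝ)) fun h => h * T (h⁻¹ • Pi.single j 1) i

/-- The limits defining the lower bounding matrix of an interference mapping exist. -/
theorem tendsto_lowerBoundingMatrix {N : ℕ} {T : (Fin N → ℝ) → (Fin N → ℝ)}
    (hT : IsInterferenceMapping T) (i j : Fin N) :
    Tendsto (fun h : ℝ => h * T (h⁻¹ • Pi.single j 1) i) (𝓝[>] 0)
      (𝓝 (lowerBoundingMatrix T i j)) := by
  have he : (0 : Fin N → ℝ) ≤ Pi.single j 1 := by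
    simp
  have hmem : ∀ s : ℝ, 0 ≤ s → s • (Pi.single j 1 : Fin N → ℝ) ∈ orthant N :=
    fun s hs => smul_nonneg hs he
  have hmono : MonotoneOn (fun h : ℝ => h * T (h⁻¹ • Pi.single j 1) i) (Set.Ioi 0) := by
    intro h hh k hk hhk
    have hh' : (0 : ℝ) < h := hh
    have hk' : (0 : ℝ) < k := hk
    have hle : h / k ≤ 1 := (div_le_one hk').2 hhk
    have h0 : (0 : Fin N → ℝ) ∈ orthant N := le_refl (0 : Fin N → ℝ)
    have hc := hT.concaveOn.2 (hmem h⁻¹ (by positivity)) h0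
      (show 0 ≤ h / k by positivity) (show 0 ≤ 1 - h / k by linarith) (by ring)
    have hci := hc i
    have hpt : (h / k) • h⁻¹ • (Pi.single j 1 : Fin N → ℝ) + (1 - h / k) • (0 : Fin N → ℝ)
        = k⁻¹ • Pi.single j 1 := by
      rw [smul_zero, add_zero, smul_smul]
      congr 1
      field_simp
    rw [hpt] at hci
    simp only [Pi.add_apply, Pi.smul_apply, smul_eq_mul] at hci
    have hp := hT.pos 0 h0 i
    have h1 : h / k * T (h⁻¹ • Pi.single j 1) i ≤ T (k⁻¹ • Pi.single j 1) i := by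
      nlinarith [mul_nonneg (show 0 ≤ 1 - h / k by linarith) hp.le]
    calc h * T (h⁻¹ • Pi.single j 1) i = k * (h / k * T (h⁻¹ • Pi.single j 1) i) := by
          field_simp
      _ ≤ k * T (k⁻¹ • Pi.single j 1) i := mul_le_mul_of_nonneg_left h1 hk'.le
  have hbdd : BddBelow ((fun h : ℝ => h * T (h⁻¹ • Pi.single j 1) i) '' Set.Ioi 0) := by
    refine ⟨0, ?_⟩
    rintro _ ⟨h, hh, rfl⟩
    have hh' : (0 : ℝ) < h := hh
    exact mul_nonneg hh'.le (hT.pos _ (hmem h⁻¹ (by positivity)) i).le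
  exact tendsto_nhds_limUnder ⟨_, hmono.tendsto_nhdsGT hbdd⟩

/-- The spectral radius of a real square matrix: the supremum of the absolute values of its
complex eigenvalues. -/
noncomputable def rho {N : ℕ} (M : Matrix (Fin N) (Fin N) ℝ) : ENNReal :=
  spectralRadius ℂ (M.map (algebraMap ℝ ℂ))

/-- `(p, c)` satisfies the constraints of the canonical problem with power budget `pbar`:
`p ∈ Fix (c T)`, `‖p‖_a ≤ pbar`, `p ∈ ℝ₊^N` and `c > 0`. -/
structure IsFeasible {N : ℕ} (T : (Fin N → ℝ) → (Fin N → ℝ)) (a : Seminorm ℝ (Fin N → ℝ))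
    (pbar : ℝ) (x : (Fin N → ℝ) × ℝ) : Prop where
  power_mem : x.1 ∈ orthant N
  utility_pos : 0 < x.2
  fixed : x.1 = x.2 • T x.1
  budget : a x.1 ≤ pbar

/-- `(p, c)` solves the canonical problem: it is feasible, and it maximizes the utility `c` among
all feasible tuples. -/
structure IsSolution {N : ℕ} (T : (Fin N → ℝ) → (Fin N → ℝ)) (a : Seminorm ℝ (Fin N → ℝ))
    (pbar : ℝ) (x : (Fin N → ℝ) × ℝ) : Prop where
  feasible : IsFeasible T a pbar x
  optimal : ∀ y, IsFeasible T a pbar y → y.2 ≤ x.2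

open Classical in
/-- The utility function `U`: it maps a power budget `pbar > 0` to the component `c` of the
solution `(p, c)` of the canonical problem (and it is `0` if there is no solution). -/
noncomputable def utility {N : ℕ} (T : (Fin N → ℝ) → (Fin N → ℝ))
    (a : Seminorm ℝ (Fin N → ℝ)) (pbar : ℝ) : ℝ :=
  if h : ∃ x, IsSolution T a pbar x then h.choose.2 else 0

/-- `f(x) ∈ Θ(g(x))` as `x → ∞`, for nonnegative functions `f` and `g`. -/
def IsBigThetaAtTop (f g : ℝ → ℝ) : Prop :=
  ∃ k₀ k₁ k₂ : ℝ, 0 < k₀ ∧ 0 < k₁ ∧ 0 < k₂ ∧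
    ∀ x : ℝ, k₀ ≤ x → k₁ * g x ≤ f x ∧ f x ≤ k₂ * g x

end MaxMinUtility

namespace MaxMinUtility

variable {N : ℕ}

/-! ### Monotonicity, scaling, and the linear lower bound of concave positive mappings. -/

section Mapping

variable {T : (Fin N → ℝ) → (Fin N → ℝ)}

/-! Concavity and `T 0 > 0` make `T` monotone and strictly subhomogeneous: `s T(y) < T(s y)` for `0
≤ s < 1`. Hence the normalized map `x ↦ r T(x) / ‖T(x)‖` strictly shrinks Hilbert's projective
distance (`lowRatio_mul_lowRatio_lt`). Compactness of the sphere in the orthant then gives exactly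
one pair `p = c T(p)` with `‖p‖ = r`. It solves the problem: by `le_of_eq_smul`, a feasible
competitor with utility at least `c` has power at least `p`, so it exhausts the budget as well and
must be the same pair.

For `Θ(1)`, the solution for budget 1 stays feasible for larger budgets, which bounds `U` below.
Above, `T(p) ≥ M p` gives `c M p ≤ p` with `p > 0`, so `c |l| ≤ 1` for any nonzero eigenvalue `l` of
`M`; one exists because `ρ(M) > 0`. -/

theorem IsInterferenceMapping.concave_apply (hT : IsInterferenceMapping T) {x y : Fin N → ℝ}
    (hx : 0 ≤ x) (hy : 0 ≤ y) {s t : ℝ} (hs : 0 ≤ s) (ht : 0 ≤ t) (hst : s + t = 1) (i : Fin N) :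
    s * T x i + t * T y i ≤ T (s • x + t • y) i :=
  hT.concaveOn.2 hx hy hs ht hst i

/-- Positive concave mappings on the orthant are monotone. -/
theorem IsInterferenceMapping.monotone (hT : IsInterferenceMapping T) {x y : Fin N → ℝ}
    (hx : 0 ≤ x) (hxy : x ≤ y) (i : Fin N) : T x i ≤ T y i := by
  by_contra! hlt
  have hxpos : 0 < T x i := hT.pos x hx i
  have hypos : 0 < T y i := hT.pos y (hx.trans hxy) i
  -- Chosen so that `(1 - e) T(x)_i = T(y)_i`: as `y` lies between `x` and the extrapolated point `x
  -- + e⁻¹(y - x)`, concavity leaves no room for a positive value there.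
  set e : ℝ := (T x i - T y i) / T x i with he
  have he0 : 0 < e := div_pos (by linarith) hxpos
  have he1 : e ≤ 1 := (div_le_one hxpos).2 (by linarith)
  have hz : 0 ≤ x + e⁻¹ • (y - x) :=
    add_nonneg hx (smul_nonneg (by positivity) (sub_nonneg.2 hxy))
  have h := hT.concave_apply hx hz (sub_nonneg.2 he1) he0.le (by ring) i
  have hpt : (1 - e) • x + e • (x + e⁻¹ • (y - x)) = y := by
    ext j
    simp only [Pi.add_apply, Pi.smul_apply, Pi.sub_apply, smul_eq_mul]
    field_simp
    ring
  rw [hpt] at h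
  have h1 : (1 - e) * T x i = T y i := by
    rw [he]
    field_simp
    ring
  have h2 := mul_pos he0 (hT.pos _ hz i)
  linarith

/-- Concavity between `y` and `0` leaves the surplus `(1 - s) T(0) > 0`, the source of all
strictness below. -/
theorem IsInterferenceMapping.mul_lt_of_smul_le (hT : IsInterferenceMapping T) {x y : Fin N → ℝ}
    (hy : 0 ≤ y) {s : ℝ} (hs : 0 ≤ s) (hs1 : s < 1) (h : s • y ≤ x) (i : Fin N) :
    s * T y i < T x i := by
  have h1 := hT.concave_apply hy le_rfl hs (sub_nonneg.2 hs1.le) (by ring) i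
  rw [smul_zero, add_zero] at h1
  have h2 := hT.monotone (smul_nonneg hs hy) h i
  have h3 := mul_pos (sub_pos.2 hs1) (hT.pos 0 (le_refl (0 : Fin N → ℝ)) i)
  linarith

theorem IsInterferenceMapping.mul_le_of_smul_le (hT : IsInterferenceMapping T) {x y : Fin N → ℝ}
    (hy : 0 ≤ y) {s : ℝ} (hs : 0 ≤ s) (hs1 : s ≤ 1) (h : s • y ≤ x) (i : Fin N) :
    s * T y i ≤ T x i := by
  rcases hs1.lt_or_eq with hlt | rfl
  · exact (hT.mul_lt_of_smul_le hy hs hlt h i).le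
  · rw [one_smul] at h
    rw [one_mul]
    exact hT.monotone hy h i

theorem lowerBoundingMatrix_nonneg (hT : IsInterferenceMapping T) (i j : Fin N) :
    0 ≤ lowerBoundingMatrix T i j := by
  refine ge_of_tendsto (tendsto_lowerBoundingMatrix hT i j) ?_
  filter_upwards [self_mem_nhdsWithin] with h (hh : 0 < h)
  have hmem : (0 : Fin N → ℝ) ≤ h⁻¹ • Pi.single j 1 := smul_nonneg (by positivity) (by simp)
  exact (mul_pos hh (hT.pos _ hmem i)).le

/-- Shrinking `h⁻¹ e_j` by the factor `s h ≤ 1` gives the bound for small `h`; then `h → 0⁺`. -/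
theorem mul_lowerBoundingMatrix_le (hT : IsInterferenceMapping T) {s : ℝ} (hs : 0 ≤ s)
    (i j : Fin N) : s * lowerBoundingMatrix T i j ≤ T (s • Pi.single j 1) i := by
  have hsing : (0 : Fin N → ℝ) ≤ Pi.single j 1 := by simp
  rcases hs.eq_or_lt with rfl | hpos
  · rw [zero_mul]
    exact (hT.pos _ (smul_nonneg le_rfl hsing) i).le
  refine le_of_tendsto ((tendsto_lowerBoundingMatrix hT i j).const_mul s) ?_
  filter_upwards [Ioo_mem_nhdsGT (inv_pos.2 hpos)] with h hh
  have h0 : 0 < h := hh.1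
  have h1 : s * h ≤ 1 := by
    have := mul_le_mul_of_nonneg_left hh.2.le hs
    rwa [mul_inv_cancel₀ hpos.ne'] at this
  rw [← mul_assoc]
  refine hT.mul_le_of_smul_le (smul_nonneg (by positivity) hsing) (by positivity) h1 ?_ i
  rw [smul_smul, mul_assoc, mul_inv_cancel₀ h0.ne', mul_one]

/-- An interference mapping dominates its lower bounding matrix. -/
theorem lowerBoundingMatrix_mulVec_le (hT : IsInterferenceMapping T) {p : Fin N → ℝ} (hp : 0 ≤ p)
    (i : Fin N) : ∑ j, lowerBoundingMatrix T i j * p j ≤ T p i := by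
  have hN : (N : ℝ) ≠ 0 := Nat.cast_ne_zero.2 (Fin.pos i).ne'
  have hNpos : (0 : ℝ) ≤ N := Nat.cast_nonneg N
  -- Writing `p` as the average of the axis points `N p_j e_j` lets Jensen reduce to single axes.
  have hpt : ∑ j, (N : ℝ)⁻¹ • (N * p j) • (Pi.single j 1 : Fin N → ℝ) = p := by
    ext k
    simp [Finset.sum_apply, Pi.single_apply, hN]
  have hmem : ∀ j ∈ (Finset.univ : Finset (Fin N)),
      (N * p j) • (Pi.single j 1 : Fin N → ℝ) ∈ orthant N := fun j _ =>
    smul_nonneg (mul_nonneg hNpos (hp j)) (show (0 : Fin N → ℝ) ≤ Pi.single j 1 by simp)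
  have h := hT.concaveOn.le_map_sum (fun _ _ => inv_nonneg.2 hNpos) (by simp [hN]) hmem i
  rw [hpt] at h
  refine le_trans ?_ h
  rw [Finset.sum_apply]
  refine Finset.sum_le_sum fun j _ => ?_
  have h1 := mul_le_mul_of_nonneg_left
    (mul_lowerBoundingMatrix_le hT (mul_nonneg hNpos (hp j)) i j) (inv_nonneg.2 hNpos)
  refine le_trans (le_of_eq ?_) h1
  field_simp

end Mapping

/-! ### The ratio behind Hilbert's metric: `-log (lowRatio x y * lowRatio y x)` is the distance. -/

section LowRatio

variable [NeZero N]

/-- The largest `t` with `t • y ≤ x`, for entry-wise positive `y`. -/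
noncomputable def lowRatio (x y : Fin N → ℝ) : ℝ :=
  Finset.univ.inf' Finset.univ_nonempty fun i => x i / y i

theorem le_lowRatio {x y : Fin N → ℝ} (hy : ∀ i, 0 < y i) {t : ℝ} :
    t ≤ lowRatio x y ↔ ∀ i, t * y i ≤ x i := by
  simp [lowRatio, le_div_iff₀ (hy _)]

theorem lt_lowRatio {x y : Fin N → ℝ} (hy : ∀ i, 0 < y i) {t : ℝ} :
    t < lowRatio x y ↔ ∀ i, t * y i < x i := by
  simp [lowRatio, lt_div_iff₀ (hy _)]

theorem lowRatio_smul_le {x y : Fin N → ℝ} (hy : ∀ i, 0 < y i) : lowRatio x y • y ≤ x :=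
  fun i => (le_lowRatio hy).1 le_rfl i

theorem lowRatio_pos {x y : Fin N → ℝ} (hx : ∀ i, 0 < x i) (hy : ∀ i, 0 < y i) :
    0 < lowRatio x y :=
  (lt_lowRatio hy).2 fun i => by simpa using hx i

theorem continuousOn_lowRatio {X : Type*} [TopologicalSpace X] {s : Set X}
    {f g : X → Fin N → ℝ} (hf : ContinuousOn f s) (hg : ContinuousOn g s)
    (h0 : ∀ x ∈ s, ∀ i, 0 < g x i) : ContinuousOn (fun x => lowRatio (f x) (g x)) s := by
  unfold lowRatio
  refine ContinuousOn.finset_inf'_apply _ fun i _ => ?_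
  exact (continuousOn_pi.1 hf i).div (continuousOn_pi.1 hg i) fun x hx => (h0 x hx i).ne'

end LowRatio

/-! ### Monotone norms. -/

section Norm

variable {a : Seminorm ℝ (Fin N → ℝ)}

theorem IsMonotoneNorm.pos (ha : IsMonotoneNorm a) {x : Fin N → ℝ} (hx : x ≠ 0) : 0 < a x :=
  (apply_nonneg a x).lt_of_ne fun h => hx (ha.eq_zero x h.symm)

theorem IsMonotoneNorm.le_of_smul_le (ha : IsMonotoneNorm a) {x y : Fin N → ℝ} (hy : 0 ≤ y)
    {t : ℝ} (ht : 0 ≤ t) (h : t • y ≤ x) : t * a y ≤ a x := by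
  have h0 : 0 ≤ t • y := smul_nonneg ht hy
  have := ha.mono x (h0.trans h) (t • y) h0 h
  rwa [map_smul_eq_mul, Real.norm_of_nonneg ht] at this

/-- From `x_j e_j ≤ x`, monotonicity of the norm bounds every coordinate. -/
theorem isCompact_orthant_sphere (ha : IsMonotoneNorm a) (r : ℝ) :
    IsCompact {x : Fin N → ℝ | 0 ≤ x ∧ a x = r} := by
  have hcont : Continuous a := (ConvexOn.locallyLipschitz a.convexOn).continuous
  refine IsCompact.of_isClosed_subset
    (isCompact_Icc (a := (0 : Fin N → ℝ)) (b := fun j => r / a (Pi.single j 1)))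
    (isClosed_Ici.inter (isClosed_eq hcont continuous_const)) ?_
  rintro x ⟨hx, rfl⟩
  refine ⟨hx, fun j => ?_⟩
  have hne : (Pi.single j 1 : Fin N → ℝ) ≠ 0 := by simp
  rw [le_div_iff₀ (ha.pos hne)]
  refine ha.le_of_smul_le (by simp) (hx j) fun k => ?_
  rcases eq_or_ne k j with rfl | hkj
  · simp
  · simpa [hkj] using hx k

end Norm

/-! ### Conditional eigenvectors and the unique solution. -/

section FixedPoint

variable [NeZero N] {T : (Fin N → ℝ) → (Fin N → ℝ)} {a : Seminorm ℝ (Fin N → ℝ)}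

theorem ne_zero_of_forall_pos {x : Fin N → ℝ} (hx : ∀ i, 0 < x i) : x ≠ 0 := fun h => by
  simpa [h] using hx 0

theorem IsMonotoneNorm.lowRatio_le_one (ha : IsMonotoneNorm a) {x y : Fin N → ℝ}
    (hx : ∀ i, 0 < x i) (hy : ∀ i, 0 < y i) (hxy : a x = a y) : lowRatio x y ≤ 1 := by
  have h := ha.le_of_smul_le (fun i => (hy i).le) (lowRatio_pos hx hy).le (lowRatio_smul_le hy)
  rw [hxy] at h
  have := ha.pos (ne_zero_of_forall_pos hy)
  nlinarith

theorem IsInterferenceMapping.le_lowRatio_smul (hT : IsInterferenceMapping T) {x y : Fin N → ℝ}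
    (hx : ∀ i, 0 < x i) (hy : ∀ i, 0 < y i) {α β : ℝ} (hα : 0 < α) (hβ : 0 < β)
    (h1 : lowRatio x y ≤ 1) :
    α / β * lowRatio x y ≤ lowRatio (α • T x) (β • T y) ∧
      (lowRatio x y < 1 → α / β * lowRatio x y < lowRatio (α • T x) (β • T y)) := by
  have hy0 : 0 ≤ y := fun i => (hy i).le
  have hs := (lowRatio_pos hx hy).le
  have hpos : ∀ i, 0 < (β • T y) i := fun i => mul_pos hβ (hT.pos y hy0 i)
  have heq : ∀ i, α / β * lowRatio x y * (β • T y) i = α * (lowRatio x y * T y i) := fun i => by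
    simp only [Pi.smul_apply, smul_eq_mul]
    field_simp
  refine ⟨(le_lowRatio hpos).2 fun i => ?_, fun hlt => (lt_lowRatio hpos).2 fun i => ?_⟩
  · rw [heq]
    exact mul_le_mul_of_nonneg_left (hT.mul_le_of_smul_le hy0 hs h1 (lowRatio_smul_le hy) i) hα.le
  · rw [heq]
    exact mul_lt_mul_of_pos_left (hT.mul_lt_of_smul_le hy0 hs hlt (lowRatio_smul_le hy) i) hα

/-- Normalized interference mappings are strictly contractive in Hilbert's projective metric. -/
theorem lowRatio_mul_lowRatio_lt (hT : IsInterferenceMapping T) (ha : IsMonotoneNorm a)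
    {x y : Fin N → ℝ} (hx : ∀ i, 0 < x i) (hy : ∀ i, 0 < y i) (hxy : a x = a y) (hne : x ≠ y)
    {α β : ℝ} (hα : 0 < α) (hβ : 0 < β) :
    lowRatio x y * lowRatio y x <
      lowRatio (α • T x) (β • T y) * lowRatio (β • T y) (α • T x) := by
  have hs := lowRatio_pos hx hy
  have hr := lowRatio_pos hy hx
  have hs1 := ha.lowRatio_le_one hx hy hxy
  have hr1 := ha.lowRatio_le_one hy hx hxy.symm
  obtain ⟨hle, hlt⟩ := hT.le_lowRatio_smul hx hy hα hβ hs1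
  obtain ⟨hle', hlt'⟩ := hT.le_lowRatio_smul hy hx hβ hα hr1
  have heq : lowRatio x y * lowRatio y x =
      (α / β * lowRatio x y) * (β / α * lowRatio y x) := by
    field_simp
  rw [heq]
  have hpos : 0 < α / β * lowRatio x y := by positivity
  have hpos' : 0 < β / α * lowRatio y x := by positivity
  -- If both ratios equal 1, then `x ≤ y ≤ x`; otherwise one factor grows strictly.
  rcases hs1.lt_or_eq with h | h
  · exact mul_lt_mul (hlt h) hle' hpos' (hpos.le.trans hle)
  rcases hr1.lt_or_eq with h' | h'
  · exact mul_lt_mul' hle (hlt' h') hpos'.le (hpos.trans_le hle)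
  · refine absurd (le_antisymm ?_ ?_) hne
    · simpa [h'] using lowRatio_smul_le (x := y) hx
    · simpa [h] using lowRatio_smul_le (x := x) hy

/-- Conditional eigenvectors of equal norm coincide. -/
theorem eq_of_eq_smul (hT : IsInterferenceMapping T) (ha : IsMonotoneNorm a)
    {x y : Fin N → ℝ} (hx0 : 0 ≤ x) (hy0 : 0 ≤ y) (hxy : a x = a y)
    {α β : ℝ} (hα : 0 < α) (hβ : 0 < β) (hx : x = α • T x) (hy : y = β • T y) : x = y := by
  by_contra hne
  have hxp : ∀ i, 0 < x i := fun i => by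
    rw [hx]
    exact mul_pos hα (hT.pos x hx0 i)
  have hyp : ∀ i, 0 < y i := fun i => by
    rw [hy]
    exact mul_pos hβ (hT.pos y hy0 i)
  have h := lowRatio_mul_lowRatio_lt hT ha hxp hyp hxy hne hα hβ
  rw [← hx, ← hy] at h
  exact h.false

/-- Existence of a conditional eigenvector of prescribed norm. -/
theorem exists_eq_smul (hT : IsInterferenceMapping T) (ha : IsMonotoneNorm a) {r : ℝ}
    (hr : 0 < r) : ∃ (p : Fin N → ℝ) (c : ℝ), 0 ≤ p ∧ 0 < c ∧ p = c • T p ∧ a p = r := by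
  set K : Set (Fin N → ℝ) := {x | 0 ≤ x ∧ a x = r} with hK
  have hacont : Continuous a := (ConvexOn.locallyLipschitz a.convexOn).continuous
  have hTpos : ∀ x ∈ K, 0 < a (T x) := fun x hx =>
    ha.pos (ne_zero_of_forall_pos (hT.pos x hx.1))
  have hTcont : ContinuousOn T K := hT.continuousOn.mono fun x hx => hx.1
  set G : (Fin N → ℝ) → (Fin N → ℝ) := fun x => (r / a (T x)) • T x with hG
  have hGcont : ContinuousOn G K :=
    (continuousOn_const.div (hacont.comp_continuousOn hTcont) fun x hx => (hTpos x hx).ne').smul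
      hTcont
  have hGpos : ∀ x ∈ K, ∀ i, 0 < G x i := fun x hx i =>
    mul_pos (div_pos hr (hTpos x hx)) (hT.pos x hx.1 i)
  have hGK : Set.MapsTo G K K := fun x hx => by
    refine ⟨fun i => (hGpos x hx i).le, ?_⟩
    have h := hTpos x hx
    rw [hG, map_smul_eq_mul, Real.norm_of_nonneg (by positivity), div_mul_cancel₀ _ h.ne']
  have hne : K.Nonempty := by
    have h1 : 0 < a (1 : Fin N → ℝ) := ha.pos one_ne_zero
    refine ⟨(r / a 1) • 1, smul_nonneg (by positivity) zero_le_one, ?_⟩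
    rw [map_smul_eq_mul, Real.norm_of_nonneg (by positivity), div_mul_cancel₀ _ h1.ne']
  have hcont : ContinuousOn
      (fun x => lowRatio (G x) (G (G x)) * lowRatio (G (G x)) (G x)) K := by
    have hGG : ContinuousOn (fun x => G (G x)) K := hGcont.comp hGcont hGK
    exact (continuousOn_lowRatio hGcont hGG fun x hx => hGpos _ (hGK hx)).mul
      (continuousOn_lowRatio hGG hGcont fun x hx => hGpos x hx)
  -- The maximizer minimizes the distance from `G x` to `G (G x)`; if these differed, passing to `G
  -- x` would strictly decrease it.
  obtain ⟨x, hx, hmax⟩ := (isCompact_orthant_sphere ha r).exists_isMaxOn hne hcont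
  have hx1 := hGK hx
  have hx2 := hGK hx1
  have hfix : G x = G (G x) := by
    by_contra hcon
    have hlt := lowRatio_mul_lowRatio_lt hT ha (hGpos x hx) (hGpos _ hx1)
      (hx1.2.trans hx2.2.symm) hcon (div_pos hr (hTpos _ hx1)) (div_pos hr (hTpos _ hx2))
    exact (lt_of_lt_of_le hlt (hmax hx1)).false
  exact ⟨G x, r / a (T (G x)), hx1.1, div_pos hr (hTpos _ hx1), hfix, hx1.2⟩

/-- A larger utility forces entry-wise larger powers. -/
theorem le_of_eq_smul (hT : IsInterferenceMapping T) {p q : Fin N → ℝ} (hp0 : 0 ≤ p)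
    (hq0 : 0 ≤ q) {c d : ℝ} (hc : 0 < c) (hcd : c ≤ d) (hp : p = c • T p) (hq : q = d • T q) :
    p ≤ q := by
  have hd := hc.trans_le hcd
  have hpp : ∀ i, 0 < p i := fun i => by
    rw [hp]
    exact mul_pos hc (hT.pos p hp0 i)
  have hqp : ∀ i, 0 < q i := fun i => by
    rw [hq]
    exact mul_pos hd (hT.pos q hq0 i)
  have hs := lowRatio_pos hqp hpp
  have hsle := lowRatio_smul_le (x := q) hpp
  by_cases h1 : 1 ≤ lowRatio q p
  · intro i
    simpa using (le_lowRatio hpp).1 h1 i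
  · push Not at h1
    refine absurd ((lt_lowRatio hpp).2 fun i => ?_) (lt_irrefl (lowRatio q p))
    have h2 := hT.mul_lt_of_smul_le hp0 hs.le h1 hsle i
    have hpi : p i = c * T p i := congrFun hp i
    have hqi : q i = d * T q i := congrFun hq i
    calc lowRatio q p * p i = c * (lowRatio q p * T p i) := by rw [hpi]; ring
      _ < c * T q i := mul_lt_mul_of_pos_left h2 hc
      _ ≤ d * T q i := mul_le_mul_of_nonneg_right hcd (hT.pos q hq0 i).le
      _ = q i := hqi.symm

theorem existsUnique_isSolution (hT : IsInterferenceMapping T) (ha : IsMonotoneNorm a) {r : ℝ}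
    (hr : 0 < r) : ∃! x, IsSolution T a r x := by
  obtain ⟨p, c, hp0, hc, hp, hpr⟩ := exists_eq_smul hT ha hr
  have key : ∀ y, IsFeasible T a r y → c ≤ y.2 → y = (p, c) := by
    rintro ⟨q, d⟩ hy (hcd : c ≤ d)
    have hq0 : 0 ≤ q := hy.power_mem
    have hd : 0 < d := hy.utility_pos
    have hq : q = d • T q := hy.fixed
    have hle := le_of_eq_smul hT hp0 hq0 hc hcd hp hq
    have haq : a q = a p := le_antisymm (hy.budget.trans_eq hpr.symm) (ha.mono q hq0 p hp0 hle)
    obtain rfl : q = p := eq_of_eq_smul hT ha hq0 hp0 haq hd hc hq hp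
    have h0 := congrFun (hp.symm.trans hq) 0
    simp only [Pi.smul_apply, smul_eq_mul] at h0
    rw [mul_right_cancel₀ (hT.pos q hq0 0).ne' h0]
  have hfeas : IsFeasible T a r (p, c) := ⟨hp0, hc, hp, hpr.le⟩
  refine ⟨(p, c), ⟨hfeas, fun y hy => ?_⟩, fun y hy => key y hy.feasible (hy.optimal _ hfeas)⟩
  by_contra! hlt
  rw [key y hy hlt.le] at hlt
  exact hlt.false

end FixedPoint

/-! ### Eigenvalues of the lower bounding matrix and the upper bound on the utility. -/

theorem exists_eigenvector_of_rho_pos {M : Matrix (Fin N) (Fin N) ℝ} (hM : 0 < rho M) :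
    ∃ (l : ℂ) (v : Fin N → ℂ), l ≠ 0 ∧ v ≠ 0 ∧ ∀ i, ∑ j, (M i j : ℂ) * v j = l * v i := by
  obtain ⟨l, hl⟩ := lt_iSup_iff.1 hM
  obtain ⟨hmem, hl0⟩ := lt_iSup_iff.1 hl
  rw [← Matrix.spectrum_toLin', ← Module.End.hasEigenvalue_iff_mem_spectrum] at hmem
  obtain ⟨v, hv⟩ := hmem.exists_hasEigenvector
  refine ⟨l, v, fun h => ?_, hv.2, fun i => ?_⟩
  · simp [h] at hl0
  · simpa [Matrix.mulVec, dotProduct] using congrFun hv.apply_eq_smul i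

/-- If `c M p ≤ p` with `M ≥ 0` and `p > 0`, then eigenvalues of `M` are at most `1 / c` in
absolute value. -/
theorem mul_norm_eigenvalue_le_one {M : Matrix (Fin N) (Fin N) ℝ} (hM : ∀ i j, 0 ≤ M i j)
    {p : Fin N → ℝ} (hp : ∀ i, 0 < p i) {c : ℝ} (hc : 0 < c)
    (h : ∀ i, c * ∑ j, M i j * p j ≤ p i) {l : ℂ} {v : Fin N → ℂ} (hv : v ≠ 0)
    (hl : ∀ i, ∑ j, (M i j : ℂ) * v j = l * v i) : c * ‖l‖ ≤ 1 := by
  obtain ⟨k, hk⟩ := Function.ne_iff.1 hv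
  have : Nonempty (Fin N) := ⟨k⟩
  -- The eigenvalue equation is read at the index where `v` is largest in the `p`-weighted sup norm.
  obtain ⟨m, hm⟩ := Finite.exists_max fun i => ‖v i‖ / p i
  set s := ‖v m‖ / p m with hs
  have hspos : 0 < s := (div_pos (norm_pos_iff.2 hk) (hp k)).trans_le (hm k)
  have hvs : ∀ j, ‖v j‖ ≤ s * p j := fun j => (div_le_iff₀ (hp j)).1 (hm j)
  have hvm : ‖v m‖ = s * p m := (div_mul_cancel₀ _ (hp m).ne').symm
  have h1 : ‖l‖ * ‖v m‖ ≤ s * ∑ j, M m j * p j := by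
    rw [← norm_mul, ← hl m, Finset.mul_sum]
    refine (norm_sum_le _ _).trans (Finset.sum_le_sum fun j _ => ?_)
    rw [norm_mul, Complex.norm_real, Real.norm_of_nonneg (hM m j), mul_left_comm]
    exact mul_le_mul_of_nonneg_left (hvs j) (hM m j)
  have h2 : c * ‖l‖ * (s * p m) ≤ 1 * (s * p m) := by
    calc c * ‖l‖ * (s * p m) = c * (‖l‖ * ‖v m‖) := by rw [hvm]; ring
      _ ≤ c * (s * ∑ j, M m j * p j) := mul_le_mul_of_nonneg_left h1 hc.le
      _ = s * (c * ∑ j, M m j * p j) := by ring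
      _ ≤ s * p m := mul_le_mul_of_nonneg_left (h m) hspos.le
      _ = 1 * (s * p m) := (one_mul _).symm
  exact le_of_mul_le_mul_right h2 (mul_pos hspos (hp m))

theorem exists_isSolution_utility_eq {T : (Fin N → ℝ) → (Fin N → ℝ)}
    {a : Seminorm ℝ (Fin N → ℝ)} {r : ℝ} (h : ∃ x, IsSolution T a r x) :
    ∃ x, IsSolution T a r x ∧ utility T a r = x.2 :=
  ⟨h.choose, h.choose_spec, by rw [utility, dif_pos h]⟩

end MaxMinUtility

theorem mainTheorem5 {N : ℕ} (T : (Fin N → ℝ) → (Fin N → ℝ)) (a : Seminorm ℝ (Fin N → ℝ))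
    (hT : MaxMinUtility.IsInterferenceMapping T) (ha : MaxMinUtility.IsMonotoneNorm a)
    (hM : 0 < MaxMinUtility.rho (MaxMinUtility.lowerBoundingMatrix T)) :
    (∀ pbar : ℝ, 0 < pbar → ∃! x, MaxMinUtility.IsSolution T a pbar x) ∧
      MaxMinUtility.IsBigThetaAtTop (MaxMinUtility.utility T a) (fun _ => 1) := by
  obtain ⟨l, v, hl, hv, heig⟩ := MaxMinUtility.exists_eigenvector_of_rho_pos hM
  obtain ⟨k, -⟩ := Function.ne_iff.1 hv
  -- Dimension zero is excluded by the nonzero eigenvector.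
  have : NeZero N := ⟨(Fin.pos k).ne'⟩
  have hex : ∀ pbar : ℝ, 0 < pbar → ∃! x, MaxMinUtility.IsSolution T a pbar x :=
    fun _ hr => MaxMinUtility.existsUnique_isSolution hT ha hr
  refine ⟨hex, ?_⟩
  obtain ⟨x₁, hx₁, -⟩ := hex 1 one_pos
  have hlpos : 0 < ‖l‖ := norm_pos_iff.2 hl
  refine ⟨1, x₁.2, ‖l‖⁻¹, one_pos, hx₁.feasible.utility_pos, inv_pos.2 hlpos, fun r hr => ?_⟩
  obtain ⟨x, hx, hU⟩ := MaxMinUtility.exists_isSolution_utility_eq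
    (hex r (one_pos.trans_le hr)).exists
  rw [hU, mul_one, mul_one]
  have hf := hx.feasible
  constructor
  · have hf₁ := hx₁.feasible
    exact hx.optimal x₁ ⟨hf₁.power_mem, hf₁.utility_pos, hf₁.fixed, hf₁.budget.trans hr⟩
  · have hc := hf.utility_pos
    have hfix : ∀ i, x.1 i = x.2 * T x.1 i := fun i => congrFun hf.fixed i
    rw [← one_div, le_div_iff₀ hlpos]
    refine MaxMinUtility.mul_norm_eigenvalue_le_one
      (MaxMinUtility.lowerBoundingMatrix_nonneg hT) (p := x.1) (fun i => ?_) hc (fun i => ?_)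
      hv heig
    · rw [hfix i]
      exact mul_pos hc (hT.pos _ hf.power_mem i)
    · rw [hfix i]
      exact mul_le_mul_of_nonneg_left
        (MaxMinUtility.lowerBoundingMatrix_mulVec_le hT hf.power_mem i) hc.le
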